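/- Let $R$ be a commutative ring and let $\mathcal A$ be the category of connected graded $R$-algebras, i.e. algebras $A=\bigoplus_{n\ge 0}A_n$ whose unit map $R\to A_0$ is an isomorphism, with degree-preserving algebra homomorphisms. Let $*$ denote the coproduct in $\mathcal A$ (the free product of algebras, graded by total degree), and let $A$ be a cogroup in $\mathcal A$ with respect to $*$, with comultiplication $\Phi:A\to A*A$, counit the augmentation $\varepsilon:A\to R$, and inverse $\nu:A\to A$ (a morphism of $\mathcal A$). Let $\Delta:A\to A\otimes_R A$ be the composite of $\Phi$ with the canonical algebra homomorphism $A*A\to A\otimes_R A$ that is $a\mapsto a\otimes 1$ on the first factor and $a\mapsto 1\otimes a$ on the second, where $A\otimes_R A$ has the multiplication $(a\otimes b)(c\otimes d)=(-1)^{|b||c|}ac\otimes bd$. With $\mu:A\otimes_R A\to A$ the multiplication and $\eta:R\to A$ the unit, there is a unique homomorphism of graded $R$-modules $\chi:A\to A$ with $$\mu(\chi\otimes 1_A)\Delta=\eta\varepsilon=\mu(1_A\otimes\chi)\Delta,$$ the antipode of the underlying Hopf algebra of $A$, and the following are equivalent: (i) $\nu=\chi$; (ii) $\chi$ is a homomorphism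 of graded algebras; (iii) $A$ is commutative as a graded algebra, i.e. $ab=(-1)^{pq}ba$ for all $a\in A_p$, $b\in A_q$. -/

import Mathlib

open scoped DirectSum TensorProduct

noncomputable section

/-- A graded algebra `A = ⨁ₙ Aₙ` (`n ≥ 0`) over `R` is connected if the unit map `R → A₀` is an
isomorphism. -/
class ConnectedGraded {R A : Type*} [CommRing R] [Ring A] [Algebra R A]
    (𝒜 : ℕ → Submodule R A) [GradedAlgebra 𝒜] : Prop where
  bijective_algebraMap : Function.Bijective (algebraMap R (𝒜 0))

namespace ConnectedGraded

/-- The augmentation `A → A₀ ≅ R` of a connected graded algebra. -/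
def augmentation {R A : Type*} [CommRing R] [Ring A] [Algebra R A]
    (𝒜 : ℕ → Submodule R A) [GradedAlgebra 𝒜] [ConnectedGraded 𝒜] : A →ₐ[R] R :=
  ((AlgEquiv.ofBijective (Algebra.ofId R (𝒜 0)) bijective_algebraMap).symm :
      (𝒜 0) →ₐ[R] R).comp
    { GradedRing.projZeroRingHom' 𝒜 with
      commutes' := fun r => GradedRing.projZeroRingHom'_apply_coe 𝒜 (algebraMap R (𝒜 0) r) }

theorem algebraMap_augmentation {R A : Type*} [CommRing R] [Ring A] [Algebra R A]
    (𝒜 : ℕ → Submodule R A) [GradedAlgebra 𝒜] [ConnectedGraded 𝒜] (a : A) :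
    algebraMap R A (augmentation 𝒜 a) = (DirectSum.decompose 𝒜 a 0 : A) := by
  have h := (AlgEquiv.ofBijective (Algebra.ofId R (𝒜 0))
    bijective_algebraMap).apply_symm_apply (GradedRing.projZeroRingHom' 𝒜 a)
  exact congrArg (Subtype.val) h

/-- The composite `A → R → A` of the augmentation and the unit, which is the trivial
endomorphism of `A` in the category of connected graded algebras. -/
def trivialHom {R A : Type*} [CommRing R] [Ring A] [Algebra R A]
    (𝒜 : ℕ → Submodule R A) [GradedAlgebra 𝒜] [ConnectedGraded 𝒜] : A →ₐ[R] A :=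
  (Algebra.ofId R A).comp (augmentation 𝒜)

end ConnectedGraded

/-! ### Coproducts of graded algebras

The coproduct is the free product of algebras, graded by total degree. -/

namespace GradedCoprod

open LinearAlgebra

variable {R : Type*} [CommRing R] {I : Type*} [DecidableEq I] {A : I → Type*}
  [∀ i, Ring (A i)] [∀ i, Algebra R (A i)]

/-- `IsMonomial 𝒜 n x` says that `x` is a product of elements of the factors, homogeneous of
degrees that add up to `n`. -/
inductive IsMonomial (𝒜 : ∀ i, ℕ → Submodule R (A i)) : ℕ → FreeProduct R A → Prop
  | one : IsMonomial 𝒜 0 1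
  | cons {i : I} {m n : ℕ} {a : A i} {x : FreeProduct R A} (ha : a ∈ 𝒜 i m)
      (hx : IsMonomial 𝒜 n x) : IsMonomial 𝒜 (m + n) (FreeProduct.ι R A i a * x)

/-- The grading of the free product by total degree. -/
def grading (𝒜 : ∀ i, ℕ → Submodule R (A i)) (n : ℕ) : Submodule R (FreeProduct R A) :=
  Submodule.span R {x | IsMonomial 𝒜 n x}

variable (𝒜 : ∀ i, ℕ → Submodule R (A i))

theorem IsMonomial.mul {m n : ℕ} {x y : FreeProduct R A} (hx : IsMonomial 𝒜 m x)
    (hy : IsMonomial 𝒜 n y) : IsMonomial 𝒜 (m + n) (x * y) := by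
  induction hx with
  | one => simpa using hy
  | cons ha _ ih => rw [mul_assoc, add_assoc]; exact .cons ha ih

theorem ι_mem {i : I} {n : ℕ} {a : A i} (ha : a ∈ 𝒜 i n) :
    FreeProduct.ι R A i a ∈ grading 𝒜 n :=
  Submodule.subset_span (by simpa using IsMonomial.cons ha .one)

instance gradedMonoid : SetLike.GradedMonoid (grading 𝒜) where
  one_mem := Submodule.subset_span .one
  mul_mem m n x y hx hy := by
    refine Submodule.span_induction₂ (p := fun x y _ _ => x * y ∈ grading 𝒜 (m + n))
      ?_ ?_ ?_ ?_ ?_ ?_ ?_ hx hy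
    · exact fun x y hx hy => Submodule.subset_span (hx.mul 𝒜 hy)
    · intro y _; rw [zero_mul]; exact zero_mem _
    · intro x _; rw [mul_zero]; exact zero_mem _
    · intro x y z _ _ _ h₁ h₂; rw [add_mul]; exact add_mem h₁ h₂
    · intro x y z _ _ _ h₁ h₂; rw [mul_add]; exact add_mem h₁ h₂
    · intro r x y _ _ h; rw [smul_mul_assoc]; exact Submodule.smul_mem _ r h
    · intro r x y _ _ h; rw [mul_smul_comm]; exact Submodule.smul_mem _ r h

/-- The algebra homomorphism out of the free product induced by a family of algebra
homomorphisms. -/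
def desc {B : Type*} [Ring B] [Algebra R B] (f : ∀ i, A i →ₐ[R] B) : FreeProduct R A →ₐ[R] B :=
  FreeProduct.lift R A (fun {i} => f i)

theorem desc_ι {B : Type*} [Ring B] [Algebra R B] (f : ∀ i, A i →ₐ[R] B) (i : I) (a : A i) :
    desc f (FreeProduct.ι R A i a) = f i a :=
  DFunLike.congr_fun (FreeProduct.lift_comp_ι R A (fun {i} => f i) (i := i)) a

theorem hom_ext {B : Type*} [Semiring B] [Algebra R B] {f g : FreeProduct R A →ₐ[R] B}
    (h : ∀ i a, f (FreeProduct.ι R A i a) = g (FreeProduct.ι R A i a)) : f = g := by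
  apply (FreeProduct.lift R A).symm.injective
  funext i
  exact AlgHom.ext (h i)

variable [∀ i, GradedAlgebra (𝒜 i)]

/-- The restriction to a factor of the map that splits an element of the free product into its
homogeneous components. -/
def factorHom (i : I) : (⨁ n, 𝒜 i n) →ₐ[R] ⨁ n, grading 𝒜 n :=
  DirectSum.toAlgebra R (fun n => 𝒜 i n)
    (fun n => (DirectSum.lof R ℕ (fun n => grading 𝒜 n) n).comp
      ((FreeProduct.ι R A i).toLinearMap.restrict (p := 𝒜 i n) (q := grading 𝒜 n)
        fun _ ha => ι_mem 𝒜 ha))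
    (DirectSum.of_eq_of_gradedMonoid_eq (A := fun n => grading 𝒜 n)
      (Sigma.subtype_ext rfl (map_one (FreeProduct.ι R A i))))
    (fun {m n} a b => by
      refine Eq.trans ?_ (DirectSum.of_mul_of (A := fun n => grading 𝒜 n) _ _).symm
      exact DirectSum.of_eq_of_gradedMonoid_eq (A := fun n => grading 𝒜 n)
        (Sigma.subtype_ext rfl (map_mul (FreeProduct.ι R A i) (a : A i) b)))

/-- The map that splits an element of the free product into its homogeneous components. -/
def decomposeHom : FreeProduct R A →ₐ[R] ⨁ n, grading 𝒜 n :=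
  FreeProduct.lift R A (fun {i} =>
    (factorHom 𝒜 i).comp (DirectSum.decomposeAlgEquiv (𝒜 i)).toAlgHom)

theorem decomposeHom_ι {i : I} {n : ℕ} {a : A i} (ha : a ∈ 𝒜 i n) :
    decomposeHom 𝒜 (FreeProduct.ι R A i a) =
      DirectSum.of (fun n => grading 𝒜 n) n ⟨FreeProduct.ι R A i a, ι_mem 𝒜 ha⟩ := by
  unfold decomposeHom
  refine (DFunLike.congr_fun (FreeProduct.lift_comp_ι R A _ (i := i)) a).trans ?_
  change factorHom 𝒜 i (DirectSum.decompose (𝒜 i) a) = _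
  rw [DirectSum.decompose_of_mem _ ha]
  exact DirectSum.toAddMonoid_of (β := fun n => 𝒜 i n)
    (fun n => ((DirectSum.lof R ℕ (fun n => grading 𝒜 n) n).comp
      ((FreeProduct.ι R A i).toLinearMap.restrict (p := 𝒜 i n) (q := grading 𝒜 n)
        fun _ ha => ι_mem 𝒜 ha)).toAddMonoidHom) n ⟨a, ha⟩

theorem decomposeHom_of_mem {n : ℕ} {x : FreeProduct R A} (hx : x ∈ grading 𝒜 n) :
    decomposeHom 𝒜 x = DirectSum.of (fun n => grading 𝒜 n) n ⟨x, hx⟩ := by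
  induction hx using Submodule.span_induction with
  | mem x hx =>
    induction hx with
    | one => exact map_one (decomposeHom 𝒜)
    | cons ha hx ih =>
      rw [map_mul, decomposeHom_ι 𝒜 ha, ih, DirectSum.of_mul_of]
      rfl
  | zero => rw [map_zero]; exact (map_zero _).symm
  | add x y hx hy h₁ h₂ => rw [map_add, h₁, h₂, ← map_add]; rfl
  | smul r x hx h =>
    rw [map_smul, h]
    exact (map_smul (DirectSum.lof R ℕ (fun n => grading 𝒜 n) n) r ⟨x, hx⟩).symm

instance gradedAlgebra : GradedAlgebra (grading 𝒜) :=
  GradedAlgebra.ofAlgHom (grading 𝒜) (decomposeHom 𝒜)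
    (by
      refine hom_ext fun i a => ?_
      induction a using DirectSum.Decomposition.inductionOn (𝒜 i) with
      | zero => simp
      | homogeneous a =>
        rw [AlgHom.comp_apply, decomposeHom_ι 𝒜 a.2, DirectSum.coeAlgHom_of]; rfl
      | add a b ha hb => rw [map_add, map_add, map_add, ha, hb])
    (fun n x => decomposeHom_of_mem 𝒜 x.2)

/-- The canonical morphism of a factor into the coproduct. -/
def incl (i : I) : 𝒜 i →ₐᵍ[R] grading 𝒜 :=
  { FreeProduct.ι R A i with map_mem := fun ha => ι_mem 𝒜 ha }

theorem desc_mem {B : Type*} [Ring B] [Algebra R B] (ℬ : ℕ → Submodule R B) [GradedAlgebra ℬ]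
    (f : ∀ i, 𝒜 i →ₐᵍ[R] ℬ) {n : ℕ} {x : FreeProduct R A} (hx : x ∈ grading 𝒜 n) :
    desc (fun i => (f i).toAlgHom) x ∈ ℬ n := by
  induction hx using Submodule.span_induction with
  | mem x hx =>
    induction hx with
    | one => rw [map_one]; exact SetLike.GradedOne.one_mem
    | cons ha hx ih =>
      rw [map_mul, desc_ι]
      exact SetLike.GradedMul.mul_mem ((f _).map_mem ha) ih
  | zero => rw [map_zero]; exact zero_mem _
  | add x y hx hy h₁ h₂ => rw [map_add]; exact add_mem h₁ h₂
  | smul r x hx h => rw [map_smul]; exact Submodule.smul_mem _ r h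

/-- The universal property: morphisms of graded algebras out of the factors extend uniquely to
the free product. -/
theorem existsUnique_desc {B : Type*} [Ring B] [Algebra R B] (ℬ : ℕ → Submodule R B)
    [GradedAlgebra ℬ] (f : ∀ i, 𝒜 i →ₐᵍ[R] ℬ) :
    ∃! g : grading 𝒜 →ₐᵍ[R] ℬ, ∀ i, g.comp (incl 𝒜 i) = f i := by
  refine ⟨{ desc (fun i => (f i).toAlgHom) with map_mem := desc_mem 𝒜 ℬ f }, fun i => ?_,
    fun g hg => ?_⟩
  · exact DFunLike.ext _ _ fun a => desc_ι (fun i => (f i).toAlgHom) i a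
  · have h : g.toAlgHom = desc (fun i => (f i).toAlgHom) := hom_ext fun i a =>
      (DFunLike.congr_fun (hg i) a).trans (desc_ι (fun i => (f i).toAlgHom) i a).symm
    exact DFunLike.ext _ _ fun x => DFunLike.congr_fun h x

/-- The coproduct of connected graded algebras is connected. -/
instance connectedGraded [∀ i, ConnectedGraded (𝒜 i)] : ConnectedGraded (grading 𝒜) where
  bijective_algebraMap := by
    constructor
    · intro r s h
      have h' : algebraMap R (FreeProduct R A) r = algebraMap R (FreeProduct R A) s :=
        congrArg Subtype.val h
      simpa using congrArg (desc fun i => ConnectedGraded.augmentation (𝒜 i)) h'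
    · have key : ∀ n (x : FreeProduct R A), IsMonomial 𝒜 n x → n = 0 →
          ∃ r, algebraMap R (FreeProduct R A) r = x := by
        intro n x hx
        induction hx with
        | one => exact fun _ => ⟨1, map_one _⟩
        | @cons i m n a x ha hx ih =>
          intro hn
          obtain ⟨rfl, rfl⟩ : m = 0 ∧ n = 0 := by omega
          obtain ⟨s, hs⟩ := ih rfl
          obtain ⟨r, hr⟩ := (ConnectedGraded.bijective_algebraMap (𝒜 := 𝒜 i)).2 ⟨a, ha⟩
          have hr' : algebraMap R (A i) r = a := congrArg Subtype.val hr
          exact ⟨r * s, by rw [map_mul, hs, ← hr', AlgHom.commutes]⟩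
      rintro ⟨x, hx⟩
      suffices h : ∃ r, algebraMap R (FreeProduct R A) r = x by
        obtain ⟨r, hr⟩ := h
        exact ⟨r, Subtype.ext hr⟩
      induction hx using Submodule.span_induction with
      | mem x hx => exact key 0 x hx rfl
      | zero => exact ⟨0, map_zero _⟩
      | add x y _ _ h₁ h₂ =>
        obtain ⟨r, rfl⟩ := h₁
        obtain ⟨s, rfl⟩ := h₂
        exact ⟨r + s, map_add _ _ _⟩
      | smul t x _ h =>
        obtain ⟨r, rfl⟩ := h
        exact ⟨t * r, by rw [map_mul, Algebra.smul_def]⟩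

end GradedCoprod

/-! ### Cogroups -/

section Cogroup

variable {R A : Type*} [CommRing R] [Ring A] [Algebra R A]

open LinearAlgebra

/-- The underlying algebra of the coproduct of `k` copies of `A`. -/
abbrev CoprodPow (R A : Type*) [CommRing R] [Ring A] [Algebra R A] (k : ℕ) : Type _ :=
  FreeProduct R (fun _ : Fin k => A)

/-- The coproduct `A * ⋯ * A` of `k` copies of a graded algebra `A`. -/
abbrev coprodPow (𝒜 : ℕ → Submodule R A) (k : ℕ) : ℕ → Submodule R (CoprodPow R A k) :=
  GradedCoprod.grading (fun _ : Fin k => 𝒜)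

/-- The homomorphism `A * A → B` that is `f` on the first factor and `g` on the second one. -/
def copair {B : Type*} [Ring B] [Algebra R B] (f g : A →ₐ[R] B) : CoprodPow R A 2 →ₐ[R] B :=
  GradedCoprod.desc ![f, g]

/-- The `i`-th canonical homomorphism `A → A * ⋯ * A`. -/
abbrev inj {k : ℕ} (i : Fin k) : A →ₐ[R] CoprodPow R A k :=
  FreeProduct.ι R (fun _ : Fin k => A) i

/-- A cogroup structure on `A` in the category of connected graded `R`-algebras. The counit
is the augmentation `A → R`, the only morphism from `A` to the initial object `R`.
Coassociativity is stated in the threefold coproduct `A * A * A`. -/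
structure GradedCogroup (𝒜 : ℕ → Submodule R A) [GradedAlgebra 𝒜] [ConnectedGraded 𝒜] where
  /-- the comultiplication `Φ : A → A * A` -/
  comul : 𝒜 →ₐᵍ[R] coprodPow 𝒜 2
  /-- the inverse `ν : A → A` -/
  inverse : 𝒜 →ₐᵍ[R] 𝒜
  coassoc :
    (copair ((copair (inj 0) (inj 1)).comp comul.toAlgHom) (inj 2)).comp comul.toAlgHom =
      ((copair (inj 0) ((copair (inj 1) (inj 2)).comp comul.toAlgHom)).comp comul.toAlgHom :
        A →ₐ[R] CoprodPow R A 3)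
  counit_left :
    (copair (ConnectedGraded.trivialHom 𝒜) (AlgHom.id R A)).comp comul.toAlgHom = AlgHom.id R A
  counit_right :
    (copair (AlgHom.id R A) (ConnectedGraded.trivialHom 𝒜)).comp comul.toAlgHom = AlgHom.id R A
  inverse_left :
    (copair inverse.toAlgHom (AlgHom.id R A)).comp comul.toAlgHom = ConnectedGraded.trivialHom 𝒜
  inverse_right :
    (copair (AlgHom.id R A) inverse.toAlgHom).comp comul.toAlgHom = ConnectedGraded.trivialHom 𝒜

namespace GradedCogroup

variable {𝒜 : ℕ → Submodule R A} [GradedAlgebra 𝒜] [ConnectedGraded 𝒜]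

/-- The comultiplication of the underlying Hopf algebra: the composite of `Φ` with the canonical
map `A * A → A ⊗ A`, `a' ↦ a ⊗ 1`, `a'' ↦ 1 ⊗ a`. The multiplication of `A ⊗ A` has the usual
sign, `(a ⊗ b) (c ⊗ d) = (-1) ^ (|b| |c|) ac ⊗ bd`. -/
def hopfComul (Γ : GradedCogroup 𝒜) : A →ₐ[R] 𝒜 ᵍ⊗[R] 𝒜 :=
  (copair (GradedTensorProduct.includeLeft 𝒜 𝒜) (GradedTensorProduct.includeRight 𝒜 𝒜)).comp
    Γ.comul.toAlgHom

/-- The convolution product `μ ∘ (f ⊗ g) ∘ Δ` of linear endomorphisms of `A`, where `Δ` is the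
comultiplication of the underlying Hopf algebra. (For maps `f`, `g` of degree zero no
sign occurs in `f ⊗ g`.) -/
def convolution (Γ : GradedCogroup 𝒜) (f g : A →ₗ[R] A) : A →ₗ[R] A :=
  LinearMap.mul' R A ∘ₗ TensorProduct.map f g ∘ₗ
    (GradedTensorProduct.of R 𝒜 𝒜).symm.toLinearMap ∘ₗ Γ.hopfComul.toLinearMap

/-- `χ` is an antipode of the underlying Hopf algebra: a map of graded modules that is a two-sided
convolution inverse of the identity. -/
structure IsAntipode (Γ : GradedCogroup 𝒜) (χ : A →ₗ[R] A) : Prop where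
  map_mem : ∀ ⦃n : ℕ⦄ ⦃a : A⦄, a ∈ 𝒜 n → χ a ∈ 𝒜 n
  convolution_left : Γ.convolution χ LinearMap.id = (ConnectedGraded.trivialHom 𝒜).toLinearMap
  convolution_right : Γ.convolution LinearMap.id χ = (ConnectedGraded.trivialHom 𝒜).toLinearMap

end GradedCogroup

/-- `A` is commutative as a graded algebra: `ab = (-1) ^ (pq) ba` for `a ∈ A_p`, `b ∈ A_q`. -/
def IsGradedCommutative (𝒜 : ℕ → Submodule R A) : Prop :=
  ∀ ⦃p q : ℕ⦄ ⦃a b : A⦄, a ∈ 𝒜 p → b ∈ 𝒜 q → a * b = (-1) ^ (p * q) * (b * a)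

end Cogroup

end

/-!
Convolution, written `⋆` in comments, is associative because the comultiplication `Δ` of the
underlying Hopf algebra is
coassociative. To see the latter, the graded tensor product is graded by total degree
(`GradedTensorProduct.totalGrading`), so that threefold graded tensor products are algebras; both
iterates of `Δ` are then the composite of the threefold comultiplication of the cogroup with the
canonical homomorphism `A * A * A → A ⊗ (A ⊗ A)` (`GradedCogroup.hopfComul_coassoc`). Since `A` is
connected, a left and a right convolution inverse of the identity can be found degree by degree
(`LinearMap.exists_isFixedPt_of_homogeneous`), and associativity makes them equal.

If `f, g : A → A` are algebra homomorphisms whose values commute in the graded sense, then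
`(f, g) : A * A → A` factors through `A ⊗ A`, and the convolution of `f` and `g` is `(f, g) ∘ Φ`
(`GradedCogroup.convolution_algHom`). With `f` or `g` trivial this gives the counit laws of `Δ`. If `A`
is graded commutative, then it applies to `f = ν` and `g = 1`, so `ν` is the antipode.

Suppose that the antipode `χ` is an algebra homomorphism. Expanding
`(χ ⋆ 1) (a b) = (χ ⋆ 1) a * (χ ⋆ 1) b` (both sides are `ηε (a b)`), the two sides agree, by induction
on the degree, up to the graded commutator of `χ b` and `a`, which therefore vanishes
(`GradedCogroup.map_mul_comm_of_isAntipode`). As `χ` is onto by another induction on the degree, `A` is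
graded commutative.
-/

/-! ### Graded tensor products -/

theorem units_neg_one_pow_smul {A : Type*} [Ring A] (n : ℕ) (a : A) :
    (-1 : ℤˣ) ^ n • a = (-1) ^ n * a := by
  rw [Units.smul_def, zsmul_eq_mul]
  push_cast
  rfl

namespace GradedTensorProduct

variable {R A B C : Type*} [CommRing R] [Ring A] [Ring B] [Ring C] [Algebra R A] [Algebra R B]
  [Algebra R C] (𝒜 : ℕ → Submodule R A) (ℬ : ℕ → Submodule R B) (𝒞 : ℕ → Submodule R C)
  [GradedAlgebra 𝒜] [GradedAlgebra ℬ] [GradedAlgebra 𝒞]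

theorem tmul_mul_tmul_of_mem {j i : ℕ} {b : B} {a' : A} (hb : b ∈ ℬ j) (ha' : a' ∈ 𝒜 i)
    (a : A) (b' : B) :
    (a ᵍ⊗ₜ[R] b * a' ᵍ⊗ₜ[R] b' : 𝒜 ᵍ⊗[R] ℬ) =
      (-1 : ℤˣ) ^ (j * i) • ((a * a') ᵍ⊗ₜ[R] (b * b')) :=
  tmul_coe_mul_coe_tmul 𝒜 ℬ a ⟨b, hb⟩ ⟨a', ha'⟩ b'

theorem includeLeft_mul_includeRight (a : A) (b : B) :
    includeLeft 𝒜 ℬ a * includeRight 𝒜 ℬ b = a ᵍ⊗ₜ[R] b :=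
  tmul_one_mul_one_tmul 𝒜 ℬ a b

theorem includeLeft_mul_includeRight_comm {i j : ℕ} {a : A} {b : B} (ha : a ∈ 𝒜 i)
    (hb : b ∈ ℬ j) :
    includeLeft 𝒜 ℬ a * includeRight 𝒜 ℬ b =
      (-1 : ℤˣ) ^ (j * i) • (includeRight 𝒜 ℬ b * includeLeft 𝒜 ℬ a) := by
  have h := tmul_mul_tmul_of_mem 𝒜 ℬ hb ha 1 1
  rw [one_mul, mul_one] at h
  rw [includeLeft_mul_includeRight]
  refine Eq.trans ?_ (congrArg _ h.symm)
  rw [smul_smul, Int.units_mul_self, one_smul]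

/-- The grading of `𝒜 ᵍ⊗[R] ℬ` by total degree. -/
noncomputable def totalGrading (n : ℕ) : Submodule R (𝒜 ᵍ⊗[R] ℬ) :=
  Submodule.span R {t | ∃ i j, i + j = n ∧ ∃ a ∈ 𝒜 i, ∃ b ∈ ℬ j, a ᵍ⊗ₜ[R] b = t}

variable {𝒜 ℬ} in
theorem tmul_mem_totalGrading {i j : ℕ} {a : A} {b : B} (ha : a ∈ 𝒜 i) (hb : b ∈ ℬ j) :
    a ᵍ⊗ₜ[R] b ∈ totalGrading 𝒜 ℬ (i + j) :=
  Submodule.subset_span ⟨i, j, rfl, a, ha, b, hb, rfl⟩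

theorem includeLeft_mem {i : ℕ} {a : A} (ha : a ∈ 𝒜 i) :
    includeLeft 𝒜 ℬ a ∈ totalGrading 𝒜 ℬ i :=
  tmul_mem_totalGrading (j := 0) ha SetLike.GradedOne.one_mem

theorem includeRight_mem {j : ℕ} {b : B} (hb : b ∈ ℬ j) :
    includeRight 𝒜 ℬ b ∈ totalGrading 𝒜 ℬ j := by
  have h := tmul_mem_totalGrading (𝒜 := 𝒜) (i := 0) SetLike.GradedOne.one_mem hb
  rwa [zero_add] at h

instance totalGrading_gradedMonoid : SetLike.GradedMonoid (totalGrading 𝒜 ℬ) where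
  one_mem := includeLeft_mem 𝒜 ℬ (SetLike.GradedOne.one_mem (A := 𝒜))
  mul_mem m n x y hx hy := by
    refine Submodule.span_induction₂ (p := fun x y _ _ => x * y ∈ totalGrading 𝒜 ℬ (m + n))
      ?_ ?_ ?_ ?_ ?_ ?_ ?_ hx hy
    · rintro _ _ ⟨i, j, rfl, a, ha, b, hb, rfl⟩ ⟨k, l, rfl, a', ha', b', hb', rfl⟩
      rw [tmul_mul_tmul_of_mem 𝒜 ℬ hb ha', add_add_add_comm, Units.smul_def]
      exact zsmul_mem (tmul_mem_totalGrading (SetLike.GradedMul.mul_mem ha ha')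
        (SetLike.GradedMul.mul_mem hb hb')) _
    · intro y _; rw [zero_mul]; exact zero_mem _
    · intro x _; rw [mul_zero]; exact zero_mem _
    · intro x y z _ _ _ h₁ h₂; rw [add_mul]; exact add_mem h₁ h₂
    · intro x y z _ _ _ h₁ h₂; rw [mul_add]; exact add_mem h₁ h₂
    · intro r x y _ _ h; rw [smul_mul_assoc]; exact Submodule.smul_mem _ r h
    · intro r x y _ _ h; rw [mul_smul_comm]; exact Submodule.smul_mem _ r h

end GradedTensorProduct

/-- An algebra homomorphism `f : A → B` which maps `𝒜 n` to `ℬ n`, as a homomorphism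
`A → ⨁ n, ℬ n`. The submodules `ℬ n` only need to be closed under products. -/
noncomputable def AlgHom.toDirectSum {R A B : Type*} [CommRing R] [Ring A] [Ring B] [Algebra R A]
    [Algebra R B] (𝒜 : ℕ → Submodule R A) [GradedAlgebra 𝒜] (ℬ : ℕ → Submodule R B)
    [SetLike.GradedMonoid ℬ] (f : A →ₐ[R] B) (hf : ∀ n, ∀ a ∈ 𝒜 n, f a ∈ ℬ n) :
    A →ₐ[R] ⨁ n, ℬ n :=
  (DirectSum.toAlgebra R (fun n => 𝒜 n)
    (fun n => (DirectSum.lof R ℕ (fun n => ℬ n) n).comp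
      (f.toLinearMap.restrict (p := 𝒜 n) (q := ℬ n) (hf n)))
    (DirectSum.of_eq_of_gradedMonoid_eq (A := fun n => ℬ n)
      (Sigma.subtype_ext rfl (map_one f)))
    (fun {m n} a b => by
      refine Eq.trans ?_ (DirectSum.of_mul_of (A := fun n => ℬ n) _ _).symm
      exact DirectSum.of_eq_of_gradedMonoid_eq (A := fun n => ℬ n)
        (Sigma.subtype_ext rfl (map_mul f (a : A) b)))).comp
    (DirectSum.decomposeAlgEquiv 𝒜).toAlgHom

theorem AlgHom.toDirectSum_of_mem {R A B : Type*} [CommRing R] [Ring A] [Ring B] [Algebra R A]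
    [Algebra R B] (𝒜 : ℕ → Submodule R A) [GradedAlgebra 𝒜] (ℬ : ℕ → Submodule R B)
    [SetLike.GradedMonoid ℬ] (f : A →ₐ[R] B) (hf : ∀ n, ∀ a ∈ 𝒜 n, f a ∈ ℬ n) {n : ℕ} {a : A}
    (ha : a ∈ 𝒜 n) :
    AlgHom.toDirectSum 𝒜 ℬ f hf a = DirectSum.of (fun n => ℬ n) n ⟨f a, hf n a ha⟩ := by
  rw [AlgHom.toDirectSum, AlgHom.comp_apply]
  refine (congrArg _ (DirectSum.decompose_of_mem 𝒜 ha)).trans ?_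
  exact DirectSum.toAddMonoid_of (β := fun n => 𝒜 n) (fun n =>
    ((DirectSum.lof R ℕ (fun n => ℬ n) n).comp
      (f.toLinearMap.restrict (p := 𝒜 n) (q := ℬ n) (hf n))).toAddMonoidHom) n ⟨a, ha⟩

namespace GradedTensorProduct

variable {R A B C : Type*} [CommRing R] [Ring A] [Ring B] [Ring C] [Algebra R A] [Algebra R B]
  [Algebra R C] (𝒜 : ℕ → Submodule R A) (ℬ : ℕ → Submodule R B) (𝒞 : ℕ → Submodule R C)
  [GradedAlgebra 𝒜] [GradedAlgebra ℬ] [GradedAlgebra 𝒞]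

/-- The map that splits an element of `𝒜 ᵍ⊗[R] ℬ` into its homogeneous components. -/
noncomputable def totalDecompose : 𝒜 ᵍ⊗[R] ℬ →ₐ[R] ⨁ n, totalGrading 𝒜 ℬ n :=
  lift 𝒜 ℬ
    (AlgHom.toDirectSum 𝒜 (totalGrading 𝒜 ℬ) (includeLeft 𝒜 ℬ) fun _ _ => includeLeft_mem 𝒜 ℬ)
    (AlgHom.toDirectSum ℬ (totalGrading 𝒜 ℬ) (includeRight 𝒜 ℬ) fun _ _ => includeRight_mem 𝒜 ℬ)
    (by
      rintro i j ⟨a, ha⟩ ⟨b, hb⟩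
      have hc := includeLeft_mul_includeRight_comm 𝒜 ℬ ha hb
      rw [AlgHom.toDirectSum_of_mem _ _ _ _ ha, AlgHom.toDirectSum_of_mem _ _ _ _ hb,
        DirectSum.of_mul_of, DirectSum.of_mul_of]
      rcases Int.units_eq_one_or ((-1 : ℤˣ) ^ (j * i)) with h | h
      · rw [h, one_smul] at hc ⊢
        exact DirectSum.of_eq_of_gradedMonoid_eq (A := fun n => totalGrading 𝒜 ℬ n)
          (Sigma.subtype_ext (add_comm i j) hc)
      · rw [h, Units.neg_smul, one_smul] at hc ⊢
        rw [← map_neg]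
        exact DirectSum.of_eq_of_gradedMonoid_eq (A := fun n => totalGrading 𝒜 ℬ n)
          (Sigma.subtype_ext (add_comm i j) hc))

theorem totalDecompose_of_mem {n : ℕ} {t : 𝒜 ᵍ⊗[R] ℬ} (ht : t ∈ totalGrading 𝒜 ℬ n) :
    totalDecompose 𝒜 ℬ t = DirectSum.of (fun n => totalGrading 𝒜 ℬ n) n ⟨t, ht⟩ := by
  induction ht using Submodule.span_induction with
  | mem t ht =>
    obtain ⟨i, j, rfl, a, ha, b, hb, rfl⟩ := ht
    rw [totalDecompose, lift_tmul, AlgHom.toDirectSum_of_mem _ _ _ _ ha,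
      AlgHom.toDirectSum_of_mem _ _ _ _ hb, DirectSum.of_mul_of]
    exact DirectSum.of_eq_of_gradedMonoid_eq (A := fun n => totalGrading 𝒜 ℬ n)
      (Sigma.subtype_ext rfl (includeLeft_mul_includeRight 𝒜 ℬ a b))
  | zero => rw [map_zero]; exact (map_zero _).symm
  | add x y hx hy h₁ h₂ => rw [map_add, h₁, h₂, ← map_add]; rfl
  | smul r x hx h =>
    rw [map_smul, h]
    exact (map_smul (DirectSum.lof R ℕ (fun n => totalGrading 𝒜 ℬ n) n) r ⟨x, hx⟩).symm

noncomputable instance totalGrading_gradedAlgebra : GradedAlgebra (totalGrading 𝒜 ℬ) :=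
  GradedAlgebra.ofAlgHom (totalGrading 𝒜 ℬ) (totalDecompose 𝒜 ℬ)
    (by
      refine algHom_ext 𝒜 ℬ (AlgHom.ext fun a => ?_) (AlgHom.ext fun b => ?_)
      · induction a using DirectSum.Decomposition.inductionOn 𝒜 with
        | zero => simp only [map_zero]
        | homogeneous a =>
          rw [AlgHom.comp_apply, AlgHom.comp_apply,
            totalDecompose_of_mem 𝒜 ℬ (includeLeft_mem 𝒜 ℬ a.2), DirectSum.coeAlgHom_of]; rfl
        | add a b ha hb => rw [map_add, map_add, ha, hb]
      · induction b using DirectSum.Decomposition.inductionOn ℬ with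
        | zero => simp only [map_zero]
        | homogeneous b =>
          rw [AlgHom.comp_apply, AlgHom.comp_apply,
            totalDecompose_of_mem 𝒜 ℬ (includeRight_mem 𝒜 ℬ b.2), DirectSum.coeAlgHom_of]; rfl
        | add a b ha hb => rw [map_add, map_add, ha, hb])
    (fun _ t => totalDecompose_of_mem 𝒜 ℬ t.2)

variable {𝒜 ℬ} in
/-- The graded tensor product of two homomorphisms of graded algebras. -/
noncomputable def map {A' B' : Type*} [Ring A'] [Ring B'] [Algebra R A'] [Algebra R B']
    {𝒜' : ℕ → Submodule R A'} {ℬ' : ℕ → Submodule R B'} [GradedAlgebra 𝒜'] [GradedAlgebra ℬ']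
    (f : A →ₐ[R] A') (g : B →ₐ[R] B') (hf : ∀ n, ∀ a ∈ 𝒜 n, f a ∈ 𝒜' n)
    (hg : ∀ n, ∀ b ∈ ℬ n, g b ∈ ℬ' n) : 𝒜 ᵍ⊗[R] ℬ →ₐ[R] 𝒜' ᵍ⊗[R] ℬ' :=
  lift 𝒜 ℬ ((includeLeft 𝒜' ℬ').comp f) ((includeRight 𝒜' ℬ').comp g) fun _ _ a b =>
    includeLeft_mul_includeRight_comm 𝒜' ℬ' (hf _ a a.2) (hg _ b b.2)

theorem map_tmul {A' B' : Type*} [Ring A'] [Ring B'] [Algebra R A'] [Algebra R B']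
    {𝒜' : ℕ → Submodule R A'} {ℬ' : ℕ → Submodule R B'} [GradedAlgebra 𝒜'] [GradedAlgebra ℬ']
    (f : A →ₐ[R] A') (g : B →ₐ[R] B') (hf : ∀ n, ∀ a ∈ 𝒜 n, f a ∈ 𝒜' n)
    (hg : ∀ n, ∀ b ∈ ℬ n, g b ∈ ℬ' n) (a : A) (b : B) :
    (map f g hf hg : 𝒜 ᵍ⊗[R] ℬ →ₐ[R] 𝒜' ᵍ⊗[R] ℬ') (a ᵍ⊗ₜ b) = f a ᵍ⊗ₜ g b :=
  tmul_one_mul_one_tmul 𝒜' ℬ' (f a) (g b)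

/-- The associativity homomorphism `(a ⊗ b) ⊗ c ↦ a ⊗ (b ⊗ c)` of graded tensor products. -/
noncomputable def assocHom :
    totalGrading 𝒜 ℬ ᵍ⊗[R] 𝒞 →ₐ[R] 𝒜 ᵍ⊗[R] totalGrading ℬ 𝒞 :=
  lift (totalGrading 𝒜 ℬ) 𝒞
    (map (AlgHom.id R A) (includeLeft ℬ 𝒞) (fun _ _ h => by rwa [AlgHom.id_apply])
      fun _ _ => includeLeft_mem ℬ 𝒞)
    ((includeRight 𝒜 (totalGrading ℬ 𝒞)).comp (includeRight ℬ 𝒞))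
    (by
      rintro n k ⟨t, ht⟩ ⟨c, hc⟩
      dsimp only
      induction ht using Submodule.span_induction with
      | mem t ht =>
        obtain ⟨i, j, rfl, a, ha, b, hb, rfl⟩ := ht
        have h₁ := includeLeft_mul_includeRight_comm 𝒜 (totalGrading ℬ 𝒞) ha
          (includeRight_mem ℬ 𝒞 hc)
        have h₂ := congrArg (includeRight 𝒜 (totalGrading ℬ 𝒞))
          (includeLeft_mul_includeRight_comm ℬ 𝒞 hb hc)
        rw [AlgHom.map_smul_of_tower, map_mul, map_mul] at h₂
        rw [map_tmul, ← includeLeft_mul_includeRight, AlgHom.comp_apply, mul_assoc, h₂,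
          mul_smul_comm, ← mul_assoc, AlgHom.id_apply, h₁, smul_mul_assoc, smul_smul, mul_assoc,
          ← pow_add, ← mul_add, add_comm j i]
      | zero => simp only [map_zero, zero_mul, mul_zero, smul_zero]
      | add x y _ _ h₁ h₂ => rw [map_add, add_mul, h₁, h₂, mul_add, smul_add]
      | smul r x _ h => rw [map_smul, smul_mul_assoc, h, mul_smul_comm, smul_comm])

theorem assocHom_tmul (a : A) (b : B) (c : C) :
    assocHom 𝒜 ℬ 𝒞 ((a ᵍ⊗ₜ[R] b) ᵍ⊗ₜ[R] c) = a ᵍ⊗ₜ[R] (b ᵍ⊗ₜ[R] c) := by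
  rw [assocHom, lift_tmul, map_tmul, ← includeLeft_mul_includeRight, AlgHom.comp_apply, mul_assoc,
    ← map_mul, includeLeft_mul_includeRight, includeLeft_mul_includeRight]
  rfl

end GradedTensorProduct

/-! ### Linear maps out of graded modules and graded tensor products -/

section GradedModule

variable {R A M : Type*} [CommRing R] [AddCommGroup A] [Module R A] [AddCommGroup M] [Module R M]
  (𝒜 : ℕ → Submodule R A) [DirectSum.Decomposition 𝒜]

theorem LinearMap.ext_of_homogeneous {f g : A →ₗ[R] M} (h : ∀ n, ∀ a ∈ 𝒜 n, f a = g a) : f = g :=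
  DirectSum.decompose_lhom_ext 𝒜 fun n => LinearMap.ext fun a => h n a a.2

/-- An operator `F` on linear maps such that the degree `n` part of `F f` depends only on the part
of `f` of degree less than `n` has a fixed point. -/
theorem LinearMap.exists_isFixedPt_of_homogeneous (F : (A →ₗ[R] M) → (A →ₗ[R] M))
    (hF : ∀ n f g, (∀ m < n, ∀ a ∈ 𝒜 m, f a = g a) → ∀ a ∈ 𝒜 n, F f a = F g a) :
    ∃ f, F f = f := by
  have stable : ∀ k l m, m < k → m < l → ∀ a ∈ 𝒜 m, F^[k] 0 a = F^[l] 0 a := by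
    intro k
    induction k with
    | zero => intro l m h; omega
    | succ k ih =>
      rintro (_ | l) m hk hl
      · omega
      · rw [Function.iterate_succ_apply', Function.iterate_succ_apply']
        exact hF m _ _ fun m' hm' => ih l m' (by omega) (by omega)
  -- In degree `n` the iterates of `F` are constant from the `(n + 1)`-st one on.
  let f : A →ₗ[R] M := (DirectSum.toModule R ℕ M fun n => (F^[n + 1] 0).comp (𝒜 n).subtype).comp
    (DirectSum.decomposeLinearEquiv 𝒜).toLinearMap
  have hf : ∀ n, ∀ a ∈ 𝒜 n, f a = F^[n + 1] 0 a := by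
    intro n a ha
    have h : f a = DirectSum.toModule R ℕ M (fun n => (F^[n + 1] 0).comp (𝒜 n).subtype)
      (DirectSum.decompose 𝒜 a) := rfl
    rw [h, DirectSum.decompose_of_mem 𝒜 ha]
    exact DirectSum.toModule_lof R n _
  refine ⟨f, LinearMap.ext_of_homogeneous 𝒜 fun n a ha => ?_⟩
  rw [hf n a ha, Function.iterate_succ_apply']
  refine hF n _ _ (fun m hm b hb => ?_) a ha
  rw [hf m b hb]
  exact stable _ _ m (by omega) hm b hb

end GradedModule

namespace GradedTensorProduct

variable {R A B C : Type*} [CommRing R] [Ring A] [Ring B] [Ring C] [Algebra R A] [Algebra R B]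
  [Algebra R C] {𝒜 : ℕ → Submodule R A} {ℬ : ℕ → Submodule R B}
  [GradedAlgebra 𝒜] [GradedAlgebra ℬ]

variable (𝒜 ℬ) in
/-- The linear map `a ⊗ b ↦ f a * g b`. For algebra homomorphisms `f` and `g` whose values commute
in the graded sense it is the algebra homomorphism `GradedTensorProduct.lift`. -/
noncomputable def mulMap (f : A →ₗ[R] C) (g : B →ₗ[R] C) : 𝒜 ᵍ⊗[R] ℬ →ₗ[R] C :=
  LinearMap.mul' R C ∘ₗ TensorProduct.map f g ∘ₗ (of R 𝒜 ℬ).symm.toLinearMap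

theorem mulMap_tmul (f : A →ₗ[R] C) (g : B →ₗ[R] C) (a : A) (b : B) :
    mulMap 𝒜 ℬ f g (a ᵍ⊗ₜ b) = f a * g b :=
  rfl

theorem linearMap_ext_tmul {M : Type*} [AddCommMonoid M] [Module R M] {f g : 𝒜 ᵍ⊗[R] ℬ →ₗ[R] M}
    (h : ∀ a b, f (a ᵍ⊗ₜ b) = g (a ᵍ⊗ₜ b)) : f = g :=
  hom_ext 𝒜 ℬ (TensorProduct.ext' h)

theorem mulMap_includeLeft {f : A →ₗ[R] C} {g : B →ₗ[R] C} (hg : g 1 = 1) (a : A) :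
    mulMap 𝒜 ℬ f g (includeLeft 𝒜 ℬ a) = f a :=
  (congrArg (f a * ·) hg).trans (mul_one _)

theorem mulMap_includeRight {f : A →ₗ[R] C} {g : B →ₗ[R] C} (hf : f 1 = 1) (b : B) :
    mulMap 𝒜 ℬ f g (includeRight 𝒜 ℬ b) = g b :=
  (congrArg (· * g b) hf).trans (one_mul _)

theorem mulMap_sub_left (f f' : A →ₗ[R] C) (g : B →ₗ[R] C) :
    mulMap 𝒜 ℬ (f - f') g = mulMap 𝒜 ℬ f g - mulMap 𝒜 ℬ f' g :=
  linearMap_ext_tmul fun a b => by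
    simp only [LinearMap.sub_apply, mulMap_tmul, sub_mul]

theorem mulMap_sub_right (f : A →ₗ[R] C) (g g' : B →ₗ[R] C) :
    mulMap 𝒜 ℬ f (g - g') = mulMap 𝒜 ℬ f g - mulMap 𝒜 ℬ f g' :=
  linearMap_ext_tmul fun a b => by
    simp only [LinearMap.sub_apply, mulMap_tmul, mul_sub]

theorem mulMap_congr {f f' : A →ₗ[R] C} {g g' : B →ₗ[R] C} {n : ℕ}
    (h : ∀ i j, i + j = n → ∀ a ∈ 𝒜 i, ∀ b ∈ ℬ j, f a * g b = f' a * g' b)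
    {t : 𝒜 ᵍ⊗[R] ℬ} (ht : t ∈ totalGrading 𝒜 ℬ n) : mulMap 𝒜 ℬ f g t = mulMap 𝒜 ℬ f' g' t := by
  induction ht using Submodule.span_induction with
  | mem t ht =>
    obtain ⟨i, j, hij, a, ha, b, hb, rfl⟩ := ht
    exact h i j hij a ha b hb
  | zero => rw [map_zero, map_zero]
  | add x y _ _ h₁ h₂ => rw [map_add, map_add, h₁, h₂]
  | smul r x _ h => rw [map_smul, map_smul, h]

theorem mulMap_mem {f : A →ₗ[R] C} {g : B →ₗ[R] C} {n : ℕ} {S : Submodule R C}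
    (h : ∀ i j, i + j = n → ∀ a ∈ 𝒜 i, ∀ b ∈ ℬ j, f a * g b ∈ S)
    {t : 𝒜 ᵍ⊗[R] ℬ} (ht : t ∈ totalGrading 𝒜 ℬ n) : mulMap 𝒜 ℬ f g t ∈ S := by
  induction ht using Submodule.span_induction with
  | mem t ht =>
    obtain ⟨i, j, hij, a, ha, b, hb, rfl⟩ := ht
    exact h i j hij a ha b hb
  | zero => rw [map_zero]; exact zero_mem _
  | add x y _ _ h₁ h₂ => rw [map_add]; exact add_mem h₁ h₂
  | smul r x _ h => rw [map_smul]; exact Submodule.smul_mem _ r h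

end GradedTensorProduct

/-! ### The augmentation -/

namespace ConnectedGraded

variable {R A : Type*} [CommRing R] [Ring A] [Algebra R A]
    (𝒜 : ℕ → Submodule R A) [GradedAlgebra 𝒜] [ConnectedGraded 𝒜]

theorem trivialHom_apply (a : A) :
    trivialHom 𝒜 a = algebraMap R A (augmentation 𝒜 a) :=
  rfl

theorem trivialHom_of_mem_zero {a : A} (ha : a ∈ 𝒜 0) : trivialHom 𝒜 a = a := by
  rw [trivialHom_apply, algebraMap_augmentation, DirectSum.decompose_of_mem_same 𝒜 ha]

theorem trivialHom_of_mem {n : ℕ} (hn : n ≠ 0) {a : A} (ha : a ∈ 𝒜 n) : trivialHom 𝒜 a = 0 := by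
  rw [trivialHom_apply, algebraMap_augmentation, DirectSum.decompose_of_mem_ne 𝒜 ha hn]

theorem trivialHom_mem {n : ℕ} {a : A} (ha : a ∈ 𝒜 n) : trivialHom 𝒜 a ∈ 𝒜 n := by
  rcases eq_or_ne n 0 with rfl | hn
  · rwa [trivialHom_of_mem_zero 𝒜 ha]
  · rw [trivialHom_of_mem 𝒜 hn ha]; exact zero_mem _

theorem trivialHom_mul_comm (a b : A) : trivialHom 𝒜 a * b = b * trivialHom 𝒜 a :=
  Algebra.commutes _ b

theorem mul_trivialHom_comm_of_mem {i j : ℕ} {a b : A} (hb : b ∈ 𝒜 j) :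
    a * trivialHom 𝒜 b = (-1 : ℤˣ) ^ (j * i) • (trivialHom 𝒜 b * a) := by
  rcases eq_or_ne j 0 with rfl | hj
  · rw [zero_mul, pow_zero, one_smul, trivialHom_mul_comm]
  · rw [trivialHom_of_mem 𝒜 hj hb, mul_zero, zero_mul, smul_zero]

theorem trivialHom_mul_comm_of_mem {i j : ℕ} {a b : A} (ha : a ∈ 𝒜 i) :
    trivialHom 𝒜 a * b = (-1 : ℤˣ) ^ (j * i) • (b * trivialHom 𝒜 a) := by
  rcases eq_or_ne i 0 with rfl | hi
  · rw [mul_zero, pow_zero, one_smul, trivialHom_mul_comm]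
  · rw [trivialHom_of_mem 𝒜 hi ha, mul_zero, zero_mul, smul_zero]

theorem map_mul_trivialHom (f : A →ₗ[R] A) (a b : A) :
    f (a * trivialHom 𝒜 b) = f a * trivialHom 𝒜 b := by
  rw [trivialHom_apply, ← Algebra.commutes, ← Algebra.smul_def, map_smul, Algebra.smul_def,
    Algebra.commutes]

theorem map_trivialHom_mul (f : A →ₗ[R] A) (a b : A) :
    f (trivialHom 𝒜 a * b) = trivialHom 𝒜 a * f b := by
  rw [trivialHom_apply, ← Algebra.smul_def, map_smul, Algebra.smul_def]

end ConnectedGraded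

/-! ### Homomorphisms out of free products -/

section Copair

open LinearAlgebra

variable {R A B C : Type*} [CommRing R] [Ring A] [Ring B] [Ring C] [Algebra R A] [Algebra R B]
  [Algebra R C]

theorem copair_inj_zero (f g : A →ₐ[R] B) (a : A) : copair f g (inj 0 a) = f a :=
  GradedCoprod.desc_ι (I := Fin 2) (A := fun _ => A) ![f, g] 0 a

theorem copair_inj_one (f g : A →ₐ[R] B) (a : A) : copair f g (inj 1 a) = g a :=
  GradedCoprod.desc_ι (I := Fin 2) (A := fun _ => A) ![f, g] 1 a

theorem coprodPow_two_hom_ext {φ ψ : CoprodPow R A 2 →ₐ[R] B}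
    (h₀ : φ.comp (inj 0) = ψ.comp (inj 0)) (h₁ : φ.comp (inj 1) = ψ.comp (inj 1)) : φ = ψ := by
  refine GradedCoprod.hom_ext fun i a => ?_
  match i with
  | 0 => exact DFunLike.congr_fun h₀ a
  | 1 => exact DFunLike.congr_fun h₁ a

theorem copair_comp_inj_zero (f g : A →ₐ[R] B) : (copair f g).comp (inj 0) = f :=
  AlgHom.ext (copair_inj_zero f g)

theorem copair_comp_inj_one (f g : A →ₐ[R] B) : (copair f g).comp (inj 1) = g :=
  AlgHom.ext (copair_inj_one f g)

theorem comp_copair (φ : B →ₐ[R] C) (f g : A →ₐ[R] B) :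
    φ.comp (copair f g) = copair (φ.comp f) (φ.comp g) := by
  refine coprodPow_two_hom_ext ?_ ?_
  · rw [AlgHom.comp_assoc, copair_comp_inj_zero, copair_comp_inj_zero]
  · rw [AlgHom.comp_assoc, copair_comp_inj_one, copair_comp_inj_one]

end Copair

/-! ### The underlying Hopf algebra -/

namespace GradedCogroup

open LinearAlgebra GradedTensorProduct ConnectedGraded

variable {R A : Type*} [CommRing R] [Ring A] [Algebra R A]
variable {𝒜 : ℕ → Submodule R A} [GradedAlgebra 𝒜] [ConnectedGraded 𝒜] (Γ : GradedCogroup 𝒜)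

theorem hopfComul_mem {n : ℕ} {a : A} (ha : a ∈ 𝒜 n) :
    Γ.hopfComul a ∈ totalGrading 𝒜 𝒜 n := by
  let f : ∀ _ : Fin 2, 𝒜 →ₐᵍ[R] totalGrading 𝒜 𝒜 :=
    ![{ includeLeft 𝒜 𝒜 with map_mem := includeLeft_mem 𝒜 𝒜 },
      { includeRight 𝒜 𝒜 with map_mem := includeRight_mem 𝒜 𝒜 }]
  have hf : GradedCoprod.desc (fun i => (f i).toAlgHom) =
      copair (includeLeft 𝒜 𝒜) (includeRight 𝒜 𝒜) := by
    refine coprodPow_two_hom_ext ?_ ?_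
    · rw [copair_comp_inj_zero]
      exact AlgHom.ext (GradedCoprod.desc_ι (fun i => (f i).toAlgHom) 0)
    · rw [copair_comp_inj_one]
      exact AlgHom.ext (GradedCoprod.desc_ι (fun i => (f i).toAlgHom) 1)
  have h := GradedCoprod.desc_mem (fun _ : Fin 2 => 𝒜) (totalGrading 𝒜 𝒜) f (Γ.comul.map_mem ha)
  rw [hf] at h
  exact h

theorem hopfComul_eq : Γ.hopfComul =
    (copair (includeLeft 𝒜 𝒜) (includeRight 𝒜 𝒜)).comp Γ.comul.toAlgHom :=
  rfl

theorem comp_hopfComul {B : Type*} [Ring B] [Algebra R B] (φ : 𝒜 ᵍ⊗[R] 𝒜 →ₐ[R] B) :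
    φ.comp Γ.hopfComul =
      (copair (φ.comp (includeLeft 𝒜 𝒜)) (φ.comp (includeRight 𝒜 𝒜))).comp Γ.comul.toAlgHom := by
  rw [hopfComul_eq, ← AlgHom.comp_assoc, comp_copair]

/-- The algebra homomorphism `Δ ⊗ 1`. -/
noncomputable def hopfComulTensorId : 𝒜 ᵍ⊗[R] 𝒜 →ₐ[R] totalGrading 𝒜 𝒜 ᵍ⊗[R] 𝒜 :=
  GradedTensorProduct.map Γ.hopfComul (AlgHom.id R A) (fun _ _ => Γ.hopfComul_mem)
    (fun _ _ h => by rwa [AlgHom.id_apply])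

/-- The algebra homomorphism `1 ⊗ Δ`. -/
noncomputable def idTensorHopfComul : 𝒜 ᵍ⊗[R] 𝒜 →ₐ[R] 𝒜 ᵍ⊗[R] totalGrading 𝒜 𝒜 :=
  GradedTensorProduct.map (AlgHom.id R A) Γ.hopfComul (fun _ _ h => by rwa [AlgHom.id_apply])
    (fun _ _ => Γ.hopfComul_mem)

theorem hopfComulTensorId_tmul (a b : A) :
    Γ.hopfComulTensorId (a ᵍ⊗ₜ b) = Γ.hopfComul a ᵍ⊗ₜ b :=
  GradedTensorProduct.map_tmul 𝒜 𝒜 _ _ _ _ a b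

theorem idTensorHopfComul_tmul (a b : A) :
    Γ.idTensorHopfComul (a ᵍ⊗ₜ b) = a ᵍ⊗ₜ Γ.hopfComul b :=
  GradedTensorProduct.map_tmul 𝒜 𝒜 _ _ _ _ a b

/-- Coassociativity of `Δ`: both sides are the composite of the threefold comultiplication
`A → A * A * A` with the canonical homomorphism to `A ⊗ (A ⊗ A)`. -/
theorem hopfComul_coassoc :
    ((assocHom 𝒜 𝒜 𝒜).comp Γ.hopfComulTensorId).comp Γ.hopfComul =
      Γ.idTensorHopfComul.comp Γ.hopfComul := by
  let i₀ := includeLeft 𝒜 (totalGrading 𝒜 𝒜)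
  let i₁ := (includeRight 𝒜 (totalGrading 𝒜 𝒜)).comp (includeLeft 𝒜 𝒜)
  let i₂ := (includeRight 𝒜 (totalGrading 𝒜 𝒜)).comp (includeRight 𝒜 𝒜)
  let T : CoprodPow R A 3 →ₐ[R] 𝒜 ᵍ⊗[R] totalGrading 𝒜 𝒜 := GradedCoprod.desc ![i₀, i₁, i₂]
  have h₀ : T.comp (inj 0) = i₀ := AlgHom.ext (GradedCoprod.desc_ι (A := fun _ => A) _ 0)
  have h₁ : T.comp (inj 1) = i₁ := AlgHom.ext (GradedCoprod.desc_ι (A := fun _ => A) _ 1)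
  have h₂ : T.comp (inj 2) = i₂ := AlgHom.ext (GradedCoprod.desc_ι (A := fun _ => A) _ 2)
  have h := congrArg T.comp Γ.coassoc
  simp only [← AlgHom.comp_assoc, comp_copair, h₀, h₁, h₂] at h
  have left₀ : ((assocHom 𝒜 𝒜 𝒜).comp Γ.hopfComulTensorId).comp (includeLeft 𝒜 𝒜) =
      (copair i₀ i₁).comp Γ.comul.toAlgHom := by
    have e : ((assocHom 𝒜 𝒜 𝒜).comp Γ.hopfComulTensorId).comp (includeLeft 𝒜 𝒜) =
        ((assocHom 𝒜 𝒜 𝒜).comp (includeLeft (totalGrading 𝒜 𝒜) 𝒜)).comp Γ.hopfComul :=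
      AlgHom.ext fun a => congrArg (assocHom 𝒜 𝒜 𝒜) (Γ.hopfComulTensorId_tmul a 1)
    rw [e, comp_hopfComul]
    congr 2
    · exact AlgHom.ext fun a => assocHom_tmul 𝒜 𝒜 𝒜 a 1 1
    · exact AlgHom.ext fun a => assocHom_tmul 𝒜 𝒜 𝒜 1 a 1
  have left₁ : ((assocHom 𝒜 𝒜 𝒜).comp Γ.hopfComulTensorId).comp (includeRight 𝒜 𝒜) = i₂ := by
    refine AlgHom.ext fun a => (congrArg (assocHom 𝒜 𝒜 𝒜) (Γ.hopfComulTensorId_tmul 1 a)).trans ?_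
    rw [map_one]
    exact assocHom_tmul 𝒜 𝒜 𝒜 1 1 a
  have right₀ : Γ.idTensorHopfComul.comp (includeLeft 𝒜 𝒜) = i₀ := by
    refine AlgHom.ext fun a => (Γ.idTensorHopfComul_tmul a 1).trans ?_
    rw [map_one]
    rfl
  have right₁ : Γ.idTensorHopfComul.comp (includeRight 𝒜 𝒜) =
      (copair i₁ i₂).comp Γ.comul.toAlgHom := by
    have e : Γ.idTensorHopfComul.comp (includeRight 𝒜 𝒜) =
        (includeRight 𝒜 (totalGrading 𝒜 𝒜)).comp Γ.hopfComul :=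
      AlgHom.ext fun a => Γ.idTensorHopfComul_tmul 1 a
    rw [e, comp_hopfComul]
  rw [comp_hopfComul, left₀, left₁, comp_hopfComul, right₀, right₁, h]

end GradedCogroup

/-! ### Convolution and the antipode -/

namespace GradedCogroup

open LinearAlgebra GradedTensorProduct ConnectedGraded

variable {R A : Type*} [CommRing R] [Ring A] [Algebra R A]
variable {𝒜 : ℕ → Submodule R A} [GradedAlgebra 𝒜] [ConnectedGraded 𝒜] (Γ : GradedCogroup 𝒜)

theorem convolution_apply (f g : A →ₗ[R] A) (a : A) :
    Γ.convolution f g a = mulMap 𝒜 𝒜 f g (Γ.hopfComul a) :=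
  rfl

theorem convolution_assoc (f g h : A →ₗ[R] A) :
    Γ.convolution (Γ.convolution f g) h = Γ.convolution f (Γ.convolution g h) := by
  have h₁ : mulMap (totalGrading 𝒜 𝒜) 𝒜 (mulMap 𝒜 𝒜 f g) h ∘ₗ
      Γ.hopfComulTensorId.toLinearMap = mulMap 𝒜 𝒜 (Γ.convolution f g) h :=
    linearMap_ext_tmul fun a b =>
      congrArg (mulMap (totalGrading 𝒜 𝒜) 𝒜 (mulMap 𝒜 𝒜 f g) h) (Γ.hopfComulTensorId_tmul a b)
  have h₂ : mulMap 𝒜 (totalGrading 𝒜 𝒜) f (mulMap 𝒜 𝒜 g h) ∘ₗ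
      Γ.idTensorHopfComul.toLinearMap = mulMap 𝒜 𝒜 f (Γ.convolution g h) :=
    linearMap_ext_tmul fun a b =>
      congrArg (mulMap 𝒜 (totalGrading 𝒜 𝒜) f (mulMap 𝒜 𝒜 g h)) (Γ.idTensorHopfComul_tmul a b)
  have h₃ : mulMap 𝒜 (totalGrading 𝒜 𝒜) f (mulMap 𝒜 𝒜 g h) ∘ₗ (assocHom 𝒜 𝒜 𝒜).toLinearMap =
      mulMap (totalGrading 𝒜 𝒜) 𝒜 (mulMap 𝒜 𝒜 f g) h := by
    refine linearMap_ext_tmul fun t c => ?_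
    let tmulRight : 𝒜 ᵍ⊗[R] 𝒜 →ₗ[R] totalGrading 𝒜 𝒜 ᵍ⊗[R] 𝒜 :=
      (of R (totalGrading 𝒜 𝒜) 𝒜).toLinearMap ∘ₗ (TensorProduct.mk R (𝒜 ᵍ⊗[R] 𝒜) A).flip c
    have h : (mulMap 𝒜 (totalGrading 𝒜 𝒜) f (mulMap 𝒜 𝒜 g h) ∘ₗ
        (assocHom 𝒜 𝒜 𝒜).toLinearMap) ∘ₗ tmulRight =
          mulMap (totalGrading 𝒜 𝒜) 𝒜 (mulMap 𝒜 𝒜 f g) h ∘ₗ tmulRight :=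
      linearMap_ext_tmul fun a b =>
        (congrArg (mulMap 𝒜 (totalGrading 𝒜 𝒜) f (mulMap 𝒜 𝒜 g h))
          (assocHom_tmul 𝒜 𝒜 𝒜 a b c)).trans (mul_assoc (f a) (g b) (h c)).symm
    exact DFunLike.congr_fun h t
  refine LinearMap.ext fun a => ?_
  rw [convolution_apply, convolution_apply, ← h₁, ← h₂, ← h₃]
  exact congrArg (mulMap 𝒜 (totalGrading 𝒜 𝒜) f (mulMap 𝒜 𝒜 g h))
    (DFunLike.congr_fun Γ.hopfComul_coassoc a)

theorem convolution_sub_left (f f' g : A →ₗ[R] A) :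
    Γ.convolution (f - f') g = Γ.convolution f g - Γ.convolution f' g :=
  LinearMap.ext fun a => DFunLike.congr_fun (mulMap_sub_left f f' g) (Γ.hopfComul a)

theorem convolution_sub_right (f g g' : A →ₗ[R] A) :
    Γ.convolution f (g - g') = Γ.convolution f g - Γ.convolution f g' :=
  LinearMap.ext fun a => DFunLike.congr_fun (mulMap_sub_right f g g') (Γ.hopfComul a)

/-- The convolution of two algebra homomorphisms whose values commute in the graded sense is
their product in the group of homomorphisms out of the cogroup `A`, since `(f, g) : A * A → A`
then factors through `A ⊗ A`. -/
theorem convolution_algHom (f g : A →ₐ[R] A)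
    (h : ∀ i j, ∀ a ∈ 𝒜 i, ∀ b ∈ 𝒜 j, f a * g b = (-1 : ℤˣ) ^ (j * i) • (g b * f a)) :
    Γ.convolution f.toLinearMap g.toLinearMap =
      ((copair f g).comp Γ.comul.toAlgHom).toLinearMap := by
  have hc : ∀ ⦃i j⦄ (a : 𝒜 i) (b : 𝒜 j), f a * g b = (-1 : ℤˣ) ^ (j * i) • (g b * f a) :=
    fun i j a b => h i j a a.2 b b.2
  let φ := lift 𝒜 𝒜 f g hc
  have h₀ : φ.comp (includeLeft 𝒜 𝒜) = f := AlgHom.ext fun a => by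
    refine (lift_tmul 𝒜 𝒜 f g hc a 1).trans ?_
    rw [map_one, mul_one]
  have h₁ : φ.comp (includeRight 𝒜 𝒜) = g := AlgHom.ext fun a => by
    refine (lift_tmul 𝒜 𝒜 f g hc 1 a).trans ?_
    rw [map_one, one_mul]
  have e := Γ.comp_hopfComul φ
  rw [h₀, h₁] at e
  rw [← e]
  rfl

theorem convolution_id_trivialHom :
    Γ.convolution LinearMap.id (trivialHom 𝒜).toLinearMap = LinearMap.id := by
  have h := Γ.convolution_algHom (AlgHom.id R A) (trivialHom 𝒜) fun i j a _ b hb =>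
    mul_trivialHom_comm_of_mem 𝒜 hb
  rwa [Γ.counit_right] at h

theorem convolution_trivialHom_id :
    Γ.convolution (trivialHom 𝒜).toLinearMap LinearMap.id = LinearMap.id := by
  have h := Γ.convolution_algHom (trivialHom 𝒜) (AlgHom.id R A) fun i j a ha b _ =>
    trivialHom_mul_comm_of_mem 𝒜 ha
  rwa [Γ.counit_left] at h

theorem convolution_trivialHom (f : A →ₗ[R] A) :
    Γ.convolution f (trivialHom 𝒜).toLinearMap = f := by
  have h : mulMap 𝒜 𝒜 f (trivialHom 𝒜).toLinearMap =
      f ∘ₗ mulMap 𝒜 𝒜 LinearMap.id (trivialHom 𝒜).toLinearMap :=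
    linearMap_ext_tmul fun a b => (map_mul_trivialHom 𝒜 f a b).symm
  refine LinearMap.ext fun a => ?_
  rw [convolution_apply, h]
  exact congrArg f (DFunLike.congr_fun Γ.convolution_id_trivialHom a)

theorem trivialHom_convolution (f : A →ₗ[R] A) :
    Γ.convolution (trivialHom 𝒜).toLinearMap f = f := by
  have h : mulMap 𝒜 𝒜 (trivialHom 𝒜).toLinearMap f =
      f ∘ₗ mulMap 𝒜 𝒜 (trivialHom 𝒜).toLinearMap LinearMap.id :=
    linearMap_ext_tmul fun a b => (map_trivialHom_mul 𝒜 f a b).symm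
  refine LinearMap.ext fun a => ?_
  rw [convolution_apply, h]
  exact congrArg f (DFunLike.congr_fun Γ.convolution_trivialHom_id a)

/-- The equation `f ⋆ 1 = ηε` solved for the top degree part of `f`: since `1 - ηε` vanishes in
degree zero, the right hand side in degree `n` only involves the part of `f` of degree less than
`n`. -/
theorem convolution_id_eq_iff (f : A →ₗ[R] A) :
    Γ.convolution f LinearMap.id = (trivialHom 𝒜).toLinearMap ↔
      (trivialHom 𝒜).toLinearMap -
        Γ.convolution f (LinearMap.id - (trivialHom 𝒜).toLinearMap) = f := by
  rw [convolution_sub_right, convolution_trivialHom, sub_sub_eq_add_sub, sub_eq_iff_eq_add,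
    add_comm f, add_left_inj, eq_comm]

theorem id_convolution_eq_iff (f : A →ₗ[R] A) :
    Γ.convolution LinearMap.id f = (trivialHom 𝒜).toLinearMap ↔
      (trivialHom 𝒜).toLinearMap -
        Γ.convolution (LinearMap.id - (trivialHom 𝒜).toLinearMap) f = f := by
  rw [convolution_sub_left, trivialHom_convolution, sub_sub_eq_add_sub, sub_eq_iff_eq_add,
    add_comm f, add_left_inj, eq_comm]

theorem id_sub_trivialHom_of_mem_zero {a : A} (ha : a ∈ 𝒜 0) :
    (LinearMap.id - (trivialHom 𝒜).toLinearMap : A →ₗ[R] A) a = 0 :=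
  sub_eq_zero.2 (trivialHom_of_mem_zero 𝒜 ha).symm

theorem id_sub_trivialHom_mem {n : ℕ} {a : A} (ha : a ∈ 𝒜 n) :
    (LinearMap.id - (trivialHom 𝒜).toLinearMap : A →ₗ[R] A) a ∈ 𝒜 n :=
  sub_mem ha (trivialHom_mem 𝒜 ha)

theorem exists_convolution_id_eq :
    ∃ f : A →ₗ[R] A, Γ.convolution f LinearMap.id = (trivialHom 𝒜).toLinearMap := by
  simp only [convolution_id_eq_iff]
  refine LinearMap.exists_isFixedPt_of_homogeneous 𝒜 _ fun n f g hfg a ha => ?_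
  refine congrArg (trivialHom 𝒜 a - ·) (mulMap_congr (fun i j hij x hx y hy => ?_)
    (Γ.hopfComul_mem ha))
  rcases eq_or_ne j 0 with rfl | hj
  · rw [id_sub_trivialHom_of_mem_zero hy, mul_zero, mul_zero]
  · rw [hfg i (by omega) x hx]

theorem exists_id_convolution_eq :
    ∃ f : A →ₗ[R] A, Γ.convolution LinearMap.id f = (trivialHom 𝒜).toLinearMap := by
  simp only [id_convolution_eq_iff]
  refine LinearMap.exists_isFixedPt_of_homogeneous 𝒜 _ fun n f g hfg a ha => ?_
  refine congrArg (trivialHom 𝒜 a - ·) (mulMap_congr (fun i j hij x hx y hy => ?_)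
    (Γ.hopfComul_mem ha))
  rcases eq_or_ne i 0 with rfl | hi
  · rw [id_sub_trivialHom_of_mem_zero hx, zero_mul, zero_mul]
  · rw [hfg j (by omega) y hy]

theorem eq_of_convolution_eq {f g : A →ₗ[R] A}
    (hf : Γ.convolution f LinearMap.id = (trivialHom 𝒜).toLinearMap)
    (hg : Γ.convolution LinearMap.id g = (trivialHom 𝒜).toLinearMap) : f = g := by
  rw [← Γ.convolution_trivialHom f, ← hg, ← convolution_assoc, hf, trivialHom_convolution]

theorem mem_of_convolution_id_eq {f : A →ₗ[R] A}
    (hf : Γ.convolution f LinearMap.id = (trivialHom 𝒜).toLinearMap) (n : ℕ) :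
    ∀ a ∈ 𝒜 n, f a ∈ 𝒜 n := by
  induction n using Nat.strong_induction_on with
  | _ n ih =>
    intro a ha
    rw [← (Γ.convolution_id_eq_iff f).1 hf]
    refine sub_mem (trivialHom_mem 𝒜 ha) (mulMap_mem (fun i j hij x hx y hy => ?_)
      (Γ.hopfComul_mem ha))
    rcases eq_or_ne j 0 with rfl | hj
    · rw [id_sub_trivialHom_of_mem_zero hy, mul_zero]; exact zero_mem _
    · rw [← hij]
      exact SetLike.GradedMul.mul_mem (ih i (by omega) x hx) (id_sub_trivialHom_mem hy)

theorem existsUnique_isAntipode : ∃! χ : A →ₗ[R] A, Γ.IsAntipode χ := by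
  obtain ⟨f, hf⟩ := Γ.exists_convolution_id_eq
  obtain ⟨g, hg⟩ := Γ.exists_id_convolution_eq
  obtain rfl := Γ.eq_of_convolution_eq hf hg
  exact ⟨f, ⟨Γ.mem_of_convolution_id_eq hf, hf, hg⟩, fun χ hχ =>
    Γ.eq_of_convolution_eq hχ.convolution_left hg⟩

/-! ### Multiplicative antipodes and graded commutativity -/

/-- If `A` is graded commutative, then `A ⊗ A → A` is an algebra homomorphism, so that the defining
equation of the inverse `ν` says that `ν` is a convolution inverse of the identity. -/
theorem inverse_eq_of_isGradedCommutative (h : IsGradedCommutative 𝒜) {χ : A →ₗ[R] A}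
    (hχ : Γ.IsAntipode χ) : Γ.inverse.toAlgHom.toLinearMap = χ := by
  refine Γ.eq_of_convolution_eq ?_ hχ.convolution_right
  have e := Γ.convolution_algHom Γ.inverse.toAlgHom (AlgHom.id R A) fun i j a ha b hb => by
    rw [units_neg_one_pow_smul, mul_comm j i]
    exact h (Γ.inverse.map_mem ha) hb
  rwa [Γ.inverse_left] at e

theorem includeRight_trivialHom_mul {x : A} (hx : x ∈ 𝒜 0) (y : A) :
    includeRight 𝒜 𝒜 (trivialHom 𝒜 x * y) = x ᵍ⊗ₜ[R] y := by
  conv_rhs => rw [← trivialHom_of_mem_zero 𝒜 hx]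
  rw [trivialHom_apply, ← Algebra.smul_def, map_smul, Algebra.algebraMap_eq_smul_one]
  exact TensorProduct.smul_tmul' _ _ _

theorem includeLeft_mul_trivialHom (x : A) {y : A} (hy : y ∈ 𝒜 0) :
    includeLeft 𝒜 𝒜 (x * trivialHom 𝒜 y) = x ᵍ⊗ₜ[R] y := by
  conv_rhs => rw [← trivialHom_of_mem_zero 𝒜 hy]
  rw [trivialHom_apply, ← Algebra.commutes, ← Algebra.smul_def, map_smul,
    Algebra.algebraMap_eq_smul_one]
  exact (TensorProduct.tmul_smul _ _ _).symm

/-- The failure of `k : x ⊗ y ↦ f x * y` to be multiplicative on `(t, u)`, when the graded commutators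
of `f b` with `a` are known to vanish for `(a, b)` of total degree less than `p + q`. It only depends
on the components `1 ⊗ a` of `t` and `b ⊗ 1` of `u`: for `t = x ⊗ y` and `u = z ⊗ w`, both sides vanish
unless `x` and `w` have degree zero, and then `t = 1 ⊗ a` and `u = b ⊗ 1`. -/
theorem mulMap_mul_sub {f : A →ₐ[R] A} {p q : ℕ}
    (ih : ∀ i j, i ≤ p → j ≤ q → i + j < p + q → ∀ a ∈ 𝒜 i, ∀ b ∈ 𝒜 j,
      f b * a = (-1 : ℤˣ) ^ (i * j) • (a * f b)) {t u : 𝒜 ᵍ⊗[R] 𝒜}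
    (ht : t ∈ totalGrading 𝒜 𝒜 p) (hu : u ∈ totalGrading 𝒜 𝒜 q) :
    mulMap 𝒜 𝒜 f.toLinearMap LinearMap.id (t * u) -
        mulMap 𝒜 𝒜 f.toLinearMap LinearMap.id t * mulMap 𝒜 𝒜 f.toLinearMap LinearMap.id u =
      mulMap 𝒜 𝒜 f.toLinearMap LinearMap.id
          (includeRight 𝒜 𝒜 (mulMap 𝒜 𝒜 (trivialHom 𝒜).toLinearMap LinearMap.id t) *
            includeLeft 𝒜 𝒜 (mulMap 𝒜 𝒜 LinearMap.id (trivialHom 𝒜).toLinearMap u)) -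
        mulMap 𝒜 𝒜 (trivialHom 𝒜).toLinearMap LinearMap.id t *
          f (mulMap 𝒜 𝒜 LinearMap.id (trivialHom 𝒜).toLinearMap u) := by
  induction ht, hu using Submodule.span_induction₂ with
  | mem_mem t u ht hu =>
    obtain ⟨i, j, rfl, x, hx, y, hy, rfl⟩ := ht
    obtain ⟨k, l, rfl, z, hz, w, hw, rfl⟩ := hu
    by_cases h : i = 0 ∧ l = 0
    · obtain ⟨rfl, rfl⟩ := h
      rw [← includeRight_trivialHom_mul hx y, ← includeLeft_mul_trivialHom z hw]
      rw [mulMap_includeRight (map_one f), mulMap_includeRight (map_one (trivialHom 𝒜)),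
        mulMap_includeLeft rfl, mulMap_includeLeft (map_one (trivialHom 𝒜))]
      rfl
    · have hlt : j + k < i + j + (k + l) := by omega
      have hs : mulMap 𝒜 𝒜 f.toLinearMap LinearMap.id (x ᵍ⊗ₜ y * z ᵍ⊗ₜ w) =
          (f x * y) * (f z * w) := by
        rw [tmul_mul_tmul_of_mem 𝒜 𝒜 hy hz, LinearMap.map_smul_of_tower, mulMap_tmul,
          AlgHom.toLinearMap_apply, map_mul, LinearMap.id_apply, mul_assoc, ← mul_assoc (f z),
          ih j k (by omega) (by omega) hlt y hy z hz, smul_mul_assoc, mul_smul_comm, smul_smul,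
          Int.units_mul_self, one_smul]
        simp only [mul_assoc]
      have h₀ : trivialHom 𝒜 x * y = 0 ∨ z * trivialHom 𝒜 w = 0 := by
        by_cases hi : i = 0
        · exact .inr (by rw [trivialHom_of_mem 𝒜 (fun hl => h ⟨hi, hl⟩) hw, mul_zero])
        · exact .inl (by rw [trivialHom_of_mem 𝒜 hi hx, zero_mul])
      rw [hs]
      simp only [mulMap_tmul, AlgHom.toLinearMap_apply, LinearMap.id_apply, sub_self]
      rcases h₀ with h₀ | h₀ <;> simp only [h₀, map_zero, zero_mul, mul_zero, sub_self]
  | zero_left u _ => simp only [zero_mul, map_zero, sub_zero]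
  | zero_right t _ => simp only [mul_zero, map_zero, sub_zero]
  | add_left t t' u _ _ _ h₁ h₂ =>
    simp only [add_mul, map_add, add_sub_add_comm, h₁, h₂]
  | add_right t u u' _ _ _ h₁ h₂ =>
    simp only [mul_add, map_add, add_sub_add_comm, h₁, h₂]
  | smul_left r t u _ _ h =>
    simp only [smul_mul_assoc, map_smul, ← smul_sub, h]
  | smul_right r t u _ _ h =>
    simp only [mul_smul_comm, map_smul, ← smul_sub, h]

/-- The values of a multiplicative antipode `f` commute with `A` in the graded sense. Indeed `f ⋆ 1` is
the algebra homomorphism `ηε`, and `(f ⋆ 1) (a b) - (f ⋆ 1) a * (f ⋆ 1) b` is the commutator of `f b`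
with `a`, up to commutators of smaller degree. -/
theorem map_mul_comm_of_isAntipode {f : A →ₐ[R] A} (hf : Γ.IsAntipode f.toLinearMap) (N : ℕ) :
    ∀ p q, p + q = N → ∀ a ∈ 𝒜 p, ∀ b ∈ 𝒜 q, f b * a = (-1 : ℤˣ) ^ (p * q) • (a * f b) := by
  induction N using Nat.strong_induction_on with
  | _ N ih =>
    rintro p q rfl a ha b hb
    have h := mulMap_mul_sub (fun i j _ _ hij => ih (i + j) hij i j rfl)
      (Γ.hopfComul_mem ha) (Γ.hopfComul_mem hb)
    rw [← map_mul] at h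
    simp only [← convolution_apply] at h
    rw [hf.convolution_left, convolution_trivialHom_id, convolution_id_trivialHom] at h
    simp only [AlgHom.toLinearMap_apply, map_mul, LinearMap.id_apply, sub_self] at h
    have hs := includeLeft_mul_includeRight_comm 𝒜 𝒜 hb ha
    have hs' := congrArg (mulMap 𝒜 𝒜 f.toLinearMap LinearMap.id) hs
    rw [LinearMap.map_smul_of_tower, sub_eq_zero.1 h.symm, includeLeft_mul_includeRight] at hs'
    exact hs'

/-- A multiplicative antipode `f` is surjective in each degree, as `f a = -a` up to terms `f x * y`
with `y` of smaller degree. -/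
theorem exists_map_eq_of_isAntipode {f : A →ₐ[R] A} (hf : Γ.IsAntipode f.toLinearMap) (n : ℕ) :
    ∀ a ∈ 𝒜 n, ∃ b ∈ 𝒜 n, f b = a := by
  induction n using Nat.strong_induction_on with
  | _ n ih =>
    intro a ha
    let S := (𝒜 n).map f.toLinearMap
    have hS : Γ.convolution (f.toLinearMap - (trivialHom 𝒜).toLinearMap) LinearMap.id a ∈ S := by
      refine mulMap_mem (fun i j hij x hx y hy => ?_) (Γ.hopfComul_mem ha)
      rw [LinearMap.sub_apply, LinearMap.id_apply, AlgHom.toLinearMap_apply,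
        AlgHom.toLinearMap_apply]
      rcases eq_or_ne i 0 with rfl | hi
      · have hfx : f x = trivialHom 𝒜 x := by
          conv_lhs => rw [← trivialHom_of_mem_zero 𝒜 hx]
          exact f.commutes _
        rw [hfx, sub_self, zero_mul]
        exact zero_mem _
      · obtain ⟨z, hz, rfl⟩ := ih j (by omega) y hy
        rw [trivialHom_of_mem 𝒜 hi hx, sub_zero, ← map_mul]
        exact ⟨x * z, hij ▸ SetLike.GradedMul.mul_mem hx hz, rfl⟩
    rw [convolution_sub_left, hf.convolution_left, convolution_trivialHom_id] at hS
    have he : trivialHom 𝒜 a ∈ S := ⟨trivialHom 𝒜 a, trivialHom_mem 𝒜 ha, f.commutes _⟩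
    have haS : a ∈ S := by simpa using sub_mem he hS
    exact haS

theorem isGradedCommutative_of_isAntipode {f : A →ₐ[R] A} (hf : Γ.IsAntipode f.toLinearMap) :
    IsGradedCommutative 𝒜 := by
  intro p q a b ha hb
  obtain ⟨c, hc, rfl⟩ := Γ.exists_map_eq_of_isAntipode hf p a ha
  rw [Γ.map_mul_comm_of_isAntipode hf _ q p rfl b hb c hc, units_neg_one_pow_smul, mul_comm q p]

end GradedCogroup

theorem theorem1p3 {R A : Type*} [CommRing R] [Ring A] [Algebra R A]
    (𝒜 : ℕ → Submodule R A) [GradedAlgebra 𝒜] [ConnectedGraded 𝒜] (Γ : GradedCogroup 𝒜) :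
    (∃! χ : A →ₗ[R] A, Γ.IsAntipode χ) ∧
      ∀ χ : A →ₗ[R] A, Γ.IsAntipode χ →
        List.TFAE [
          Γ.inverse.toAlgHom.toLinearMap = χ,
          ∃ f : 𝒜 →ₐᵍ[R] 𝒜, f.toAlgHom.toLinearMap = χ,
          IsGradedCommutative 𝒜] := by
  refine ⟨Γ.existsUnique_isAntipode, fun χ hχ => ?_⟩
  tfae_have 1 → 2 := fun h => ⟨Γ.inverse, h⟩
  tfae_have 2 → 3 := by
    rintro ⟨f, rfl⟩
    exact Γ.isGradedCommutative_of_isAntipode hχ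
  tfae_have 3 → 1 := fun h => Γ.inverse_eq_of_isGradedCommutative h hχ
  tfae_finish
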